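/- Let $d\ge 0$ and let $Y$ and $P$ be random vectors in $\mathbb R^d$ on a probability space, such that $(Y,P)$ has a joint density $f(y,p)$ with respect to Lebesgue measure on $\mathbb R^d\times\mathbb R^d$, with marginal densities $f_Y$ and $f_P$. Put $$H(Y)=-\int f_Y\log f_Y\,dy,\qquad H(Y|P)=-\iint f(y,p)\log\frac{f(y,p)}{f_P(p)}\,dy\,dp,\qquad I(Y;P)=\iint f(y,p)\log\frac{f(y,p)}{f_Y(y)f_P(p)}\,dy\,dp .$$ Assume that $Y$ has finite second moments and that the integrals defining $H(Y)$ and $H(Y|P)$ converge absolutely. For $p\in\mathbb R^d$ let $\Sigma_{Y|P=p}=\operatorname{Var}(Y\mid P=p)$ be the posterior covariance matrix, i.e. the covariance matrix of the conditional distribution of $Y$ given $P=p$, and let $\Sigma_{Y|P}=\mathbb E[\operatorname{Var}(Y\mid P)]$ be its mean over $P$. Then: 1. The integral defining $I(Y;P)$ converges absolutely, and $I(Y;P)=H(Y)-H(Y|P)$. 2. For almost every value $p$ of $P$ the conditional distribution of $Y$ given $P=p$ has finite second moments and $\Sigma_{Y|P=p}$ is symmetric positive definite. The entries of $\Sigma_{Y|P=p}$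 are integrable over the law of $P$, and $\Sigma_{Y|P}$ is symmetric positive definite. If $\Sigma_{Y|P=p}=S$ for almost every value $p$ of $P$, then $\Sigma_{Y|P}=S$. 3. $\log\big((2\pi e)^d\det\Sigma_{Y|P=p}\big)$ is integrable over the law of $P$, and $$I(Y;P)=H(Y)-H(Y|P)\;\ge\; H(Y)-\mathbb E_{p\sim P}\Big[\tfrac12\log\big((2\pi e)^d\det\Sigma_{Y|P=p}\big)\Big]\;\ge\; H(Y)-\tfrac12\log\big((2\pi e)^d\det\Sigma_{Y|P}\big).$$ 4. With $I_l(Y;P)=-\tfrac12\log\det\Sigma_{Y|P}$, the last lower bound equals $I_l(Y;P)+\big(H(Y)-\tfrac d2\log(2\pi e)\big)$, where the second summand does not involve $P$. -/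

import Mathlib

open MeasureTheory ProbabilityTheory

noncomputable section

namespace RegionMI

variable {Ω : Type*} [MeasurableSpace Ω] {d : ℕ}

/-- The real-valued (Lebesgue) probability density function `f_X` of a random vector `X`. -/
def density (X : Ω → Fin d → ℝ) (μ : Measure Ω) (x : Fin d → ℝ) : ℝ :=
  (pdf X μ volume x).toReal

/-- The joint (Lebesgue) probability density function `f_{Y,P}(y, p)`, evaluated at `z = (y, p)`. -/
def jointDensity (Y P : Ω → Fin d → ℝ) (μ : Measure Ω) (z : (Fin d → ℝ) × (Fin d → ℝ)) : ℝ :=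
  (pdf (fun ω => (Y ω, P ω)) μ volume z).toReal

/-- The integrand `f_X log f_X` of the differential entropy. -/
def entropyIntegrand (X : Ω → Fin d → ℝ) (μ : Measure Ω) (x : Fin d → ℝ) : ℝ :=
  density X μ x * Real.log (density X μ x)

/-- Differential entropy `H(X) = -∫ f_X(x) log f_X(x) dx`. -/
def entropy (X : Ω → Fin d → ℝ) (μ : Measure Ω) : ℝ :=
  -∫ x, entropyIntegrand X μ x

/-- The integrand `f(y, p) log f(y | p)` of the conditional entropy, `f(y | p) = f(y, p) / f(p)`. -/
def condEntropyIntegrand (Y P : Ω → Fin d → ℝ) (μ : Measure Ω)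
    (z : (Fin d → ℝ) × (Fin d → ℝ)) : ℝ :=
  jointDensity Y P μ z * Real.log (jointDensity Y P μ z / density P μ z.2)

/-- Conditional differential entropy `H(Y | P) = -∫∫ f(y, p) log f(y | p) dy dp`. -/
def condEntropy (Y P : Ω → Fin d → ℝ) (μ : Measure Ω) : ℝ :=
  -∫ z, condEntropyIntegrand Y P μ z

/-- The integrand `f(y, p) log (f(y, p) / (f(y) f(p)))` of the mutual information. -/
def mutualInfoIntegrand (Y P : Ω → Fin d → ℝ) (μ : Measure Ω)
    (z : (Fin d → ℝ) × (Fin d → ℝ)) : ℝ :=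
  jointDensity Y P μ z *
    Real.log (jointDensity Y P μ z / (density Y μ z.1 * density P μ z.2))

/-- Mutual information `I(Y; P) = ∫∫ f(y, p) log (f(y, p) / (f(y) f(p))) dy dp`. -/
def mutualInfo (Y P : Ω → Fin d → ℝ) (μ : Measure Ω) : ℝ :=
  ∫ z, mutualInfoIntegrand Y P μ z

/-- The posterior covariance matrix `Var(Y | P = p)`: the covariance matrix of the conditional
distribution of `Y` given `P = p`. -/
def posteriorCov (Y P : Ω → Fin d → ℝ) (μ : Measure Ω) [IsFiniteMeasure μ] (p : Fin d → ℝ) :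
    Matrix (Fin d) (Fin d) ℝ :=
  Matrix.of fun i j => cov[fun y => y i, fun y => y j; condDistrib Y P μ p]

/-- The posterior covariance matrix of `Y` given `P`, averaged over `P`: `E[Var(Y | P)]`. -/
def meanPosteriorCov (Y P : Ω → Fin d → ℝ) (μ : Measure Ω) [IsFiniteMeasure μ] :
    Matrix (Fin d) (Fin d) ℝ :=
  Matrix.of fun i j => ∫ ω, posteriorCov Y P μ (P ω) i j ∂μ

/-- `(1/2) log ((2πe)^d det S)`, the entropy of a `d`-dimensional Gaussian with covariance `S`. -/
def gaussianEntropy (S : Matrix (Fin d) (Fin d) ℝ) : ℝ :=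
  1 / 2 * Real.log ((2 * Real.pi * Real.exp 1) ^ d * S.det)

/-- The simplified objective `I_l = -(1/2) log det S`. -/
def surrogate (S : Matrix (Fin d) (Fin d) ℝ) : ℝ :=
  -(1 / 2) * Real.log S.det

end RegionMI

end

/-! Both inequalities come from `log t ≤ t - 1`. Applied to the ratio of a Gaussian density to a
density with the same mean and covariance, and integrated, it shows that the Gaussian maximises
entropy (`neg_integral_log_le_gaussianEntropy`). Applied to eigenvalues, it gives the tangent
inequality for `log det`, and integrating the tangent at the mean matrix gives Jensen's inequality
(`integral_gaussianEntropy_le`).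

The conditional law of `Y` given `P = p` has density `f(y, p) / f(p)`
(`condDistrib_ae_eq_withDensity_pdf`), so maximum entropy applies for almost every `p`. Averaging
over `P` bounds `H(Y|P)` by the mean Gaussian entropy, and Jensen bounds that by the Gaussian
entropy of the mean covariance. The Gaussian entropy is integrable because it lies between the
integrable conditional entropy and an affine function of the trace. Absolute continuity makes each
covariance nondegenerate, so no determinant vanishes. -/

/-! ### Inequalities for `log det` -/

namespace Matrix.PosDef

variable {ι : Type*} [Fintype ι] [DecidableEq ι]

open scoped MatrixOrder in
/-- A real positive definite matrix factors as `Wᵀ * W` with `W` invertible. -/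
theorem exists_transpose_mul_self {A : Matrix ι ι ℝ} (hA : A.PosDef) :
    ∃ W : Matrix ι ι ℝ, W.det ≠ 0 ∧ A = W.transpose * W := by
  obtain ⟨W, rfl⟩ := CStarAlgebra.nonneg_iff_eq_star_mul_self.mp hA.posSemidef.nonneg
  refine ⟨W, fun h => hA.det_pos.ne' ?_, by simp [star_eq_conjTranspose]⟩
  rw [det_mul, h, mul_zero]

/-- Sum `log t ≤ t - 1` over the eigenvalues. -/
theorem log_det_le_trace_sub_card {A : Matrix ι ι ℝ} (hA : A.PosDef) :
    Real.log A.det ≤ A.trace - Fintype.card ι := by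
  have h := hA.eigenvalues_pos
  rw [hA.1.det_eq_prod_eigenvalues, hA.1.trace_eq_sum_eigenvalues]
  simp only [RCLike.ofReal_real_eq_id, id]
  rw [Real.log_prod fun i _ => (h i).ne']
  calc ∑ i, Real.log (hA.1.eigenvalues i) ≤ ∑ i, (hA.1.eigenvalues i - 1) :=
        Finset.sum_le_sum fun i _ => Real.log_le_sub_one_of_pos (h i)
    _ = _ := by simp

/-- The tangent inequality expressing concavity of `log det` at `M`. -/
theorem log_det_le_log_det_add_trace {A M : Matrix ι ι ℝ} (hA : A.PosDef) (hM : M.PosDef) :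
    Real.log A.det ≤ Real.log M.det + (M⁻¹ * A).trace - Fintype.card ι := by
  obtain ⟨W, hW, hMW⟩ := hM.inv.exists_transpose_mul_self
  -- With `M⁻¹ = Wᵀ * W`, this congruence reduces to the tangent at the identity: its determinant
  -- and trace are those of `M⁻¹ * A`.
  have hC : (W * A * W.transpose).PosDef := by
    have := hA.mul_mul_conjTranspose_same (B := W)
      (Matrix.vecMul_injective_of_isUnit ((Matrix.isUnit_iff_isUnit_det W).2 hW.isUnit))
    simpa using this
  have hdet : (W * A * W.transpose).det = M.det⁻¹ * A.det := by
    have h : (M⁻¹).det = M.det⁻¹ := by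
      rw [det_nonsing_inv, Ring.inverse_eq_inv']
    rw [← h, hMW]
    simp only [det_mul, det_transpose]
    ring
  have htr : (W * A * W.transpose).trace = (M⁻¹ * A).trace := by
    rw [hMW, trace_mul_comm, ← mul_assoc]
  have := hC.log_det_le_trace_sub_card
  rw [hdet, htr, Real.log_mul (inv_ne_zero hM.det_pos.ne') hA.det_pos.ne', Real.log_inv] at this
  linarith

end Matrix.PosDef

/-! ### Gaussian integrals -/

section GaussianIntegral

variable {ι : Type*} [Fintype ι]

theorem integrable_exp_neg_half_dotProduct_self :
    Integrable (fun x : ι → ℝ => Real.exp (-(x ⬝ᵥ x) / 2)) ∧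
      ∫ x : ι → ℝ, Real.exp (-(x ⬝ᵥ x) / 2) = √(2 * Real.pi) ^ Fintype.card ι := by
  have h : (fun x : ι → ℝ => Real.exp (-(x ⬝ᵥ x) / 2)) =
      fun x => ∏ i, (fun t : ℝ => Real.exp (-(1 / 2) * t ^ 2)) (x i) := by
    ext x
    rw [← Real.exp_sum, ← Finset.mul_sum, dotProduct]
    congr 1
    simp only [sq]
    ring
  rw [h]
  refine ⟨Integrable.fintype_prod fun i => integrable_exp_neg_mul_sq (by norm_num), ?_⟩
  rw [integral_fintype_prod_volume_eq_pow (fun t : ℝ => Real.exp (-(1 / 2) * t ^ 2)),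
    integral_gaussian]
  congr 2
  ring

/-- The Gaussian integral for a nondegenerate quadratic form `|W (y - m)|²`. -/
theorem integrable_exp_neg_half_dotProduct_mulVec [DecidableEq ι] {W : Matrix ι ι ℝ} (hW : W.det ≠ 0)
    (m : ι → ℝ) :
    Integrable (fun y => Real.exp (-(W.mulVec (y - m) ⬝ᵥ W.mulVec (y - m)) / 2)) ∧
      ∫ y, Real.exp (-(W.mulVec (y - m) ⬝ᵥ W.mulVec (y - m)) / 2) =
        |W.det|⁻¹ * √(2 * Real.pi) ^ Fintype.card ι := by
  obtain ⟨hi, he⟩ := integrable_exp_neg_half_dotProduct_self (ι := ι)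
  have hmap := Real.map_matrix_volume_pi_eq_smul_volume_pi hW
  have hcont : Continuous fun x : ι → ℝ => Real.exp (-(x ⬝ᵥ x) / 2) := by
    unfold dotProduct; fun_prop
  have hmeas : AEMeasurable (Matrix.toLin' W) (volume : Measure (ι → ℝ)) :=
    (LinearMap.continuous_of_finiteDimensional _).aemeasurable
  constructor
  · refine Integrable.comp_sub_right
      (f := fun y => Real.exp (-(W.mulVec y ⬝ᵥ W.mulVec y) / 2)) ?_ m
    have : Integrable (fun x : ι → ℝ => Real.exp (-(x ⬝ᵥ x) / 2))
        (Measure.map (Matrix.toLin' W) volume) := by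
      rw [hmap]; exact hi.smul_measure ENNReal.ofReal_ne_top
    simpa [Function.comp_def] using (integrable_map_measure hcont.aestronglyMeasurable hmeas).1 this
  · rw [integral_sub_right_eq_self
      (fun y => Real.exp (-(W.mulVec y ⬝ᵥ W.mulVec y) / 2)) m]
    have : ∫ x, Real.exp (-(x ⬝ᵥ x) / 2) ∂(Measure.map (Matrix.toLin' W) volume) = _ :=
      integral_map hmeas hcont.aestronglyMeasurable
    simp only [Matrix.toLin'_apply] at this
    rw [← this, hmap, integral_smul_measure, he, ENNReal.toReal_ofReal (abs_nonneg _), abs_inv,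
      smul_eq_mul]

end GaussianIntegral

/-! ### Covariance matrices and their nondegeneracy -/

section CovarianceMatrix

variable {ι : Type*}

/-- The covariance matrix of a measure on `ι → ℝ`. -/
noncomputable def coordCov (ρ : Measure (ι → ℝ)) : Matrix ι ι ℝ :=
  Matrix.of fun i j => cov[fun y => y i, fun y => y j; ρ]

variable {ρ : Measure (ι → ℝ)}

theorem coordCov_isHermitian : (coordCov ρ).IsHermitian := by
  ext i j
  simp [coordCov, covariance_comm]

variable [Fintype ι]

theorem dotProduct_coordCov_mulVec [IsFiniteMeasure ρ] (hρ : ∀ i, MemLp (fun y : ι → ℝ => y i) 2 ρ)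
    (x : ι → ℝ) :
    x ⬝ᵥ (coordCov ρ).mulVec x = Var[fun y => x ⬝ᵥ y; ρ] := by
  have hx : ∀ i, MemLp (fun y : ι → ℝ => x i * y i) 2 ρ := fun i => (hρ i).const_mul _
  have hs : MemLp (fun y : ι → ℝ => x ⬝ᵥ y) 2 ρ := memLp_finsetSum _ fun i _ => hx i
  rw [← covariance_self hs.aemeasurable]
  simp only [dotProduct]
  rw [covariance_fun_sum_fun_sum hx hx]
  simp only [covariance_const_mul_left, covariance_const_mul_right, Matrix.mulVec, dotProduct,
    Finset.mul_sum, coordCov, Matrix.of_apply]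
  refine Finset.sum_congr rfl fun i _ => Finset.sum_congr rfl fun j _ => ?_
  ring

theorem volume_dotProduct_eq_const {v : ι → ℝ} (hv : v ≠ 0) (c : ℝ) :
    volume {y : ι → ℝ | v ⬝ᵥ y = c} = 0 := by
  let L : (ι → ℝ) →ₗ[ℝ] ℝ := dotProductBilin ℝ ℝ v
  let s : AffineSubspace ℝ (ι → ℝ) := (AffineSubspace.mk' c ⊥).comap L.toAffineMap
  have hs : (s : Set (ι → ℝ)) = {y | v ⬝ᵥ y = c} := by
    ext y
    simp [s, L, sub_eq_zero]
  rw [← hs]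
  -- The level set is a proper affine subspace: otherwise `v ⬝ᵥ y` would agree at `y = 0` and `y =
  -- v`, forcing `v = 0`.
  refine Measure.addHaar_affineSubspace volume s fun h => hv ?_
  have hall : ∀ y, v ⬝ᵥ y = c := fun y => by
    have : y ∈ (s : Set (ι → ℝ)) := by rw [h]; trivial
    rwa [hs] at this
  have h0 := hall 0
  have h1 := hall v
  rw [dotProduct_zero] at h0
  rwa [← h0, dotProduct_self_eq_zero] at h1

/-- The quadratic form at `x` is the variance of `x ⬝ᵥ y`. If it vanished for some `x ≠ 0`, `ρ`
would be carried by a hyperplane, which is Lebesgue-null. -/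
theorem posDef_coordCov [IsProbabilityMeasure ρ] (hac : ρ ≪ volume)
    (hρ : ∀ i, MemLp (fun y : ι → ℝ => y i) 2 ρ) : (coordCov ρ).PosDef := by
  refine .of_dotProduct_mulVec_pos coordCov_isHermitian fun x hx => ?_
  rw [star_trivial, dotProduct_coordCov_mulVec hρ]
  refine (variance_nonneg _ _).lt_of_ne fun h => ?_
  have hs : MemLp (fun y : ι → ℝ => x ⬝ᵥ y) 2 ρ := memLp_finsetSum _ fun i _ => (hρ i).const_mul _
  have hae := ae_eq_integral_of_variance_eq_zero hs h.symm
  have h0 : ρ {y | x ⬝ᵥ y = ρ[fun y => x ⬝ᵥ y]} = 0 := hac (volume_dotProduct_eq_const hx _)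
  have h1 : ρ Set.univ = 0 := by
    rw [← measure_union_null h0 hae]
    congr 1
    ext y
    simp
  simp at h1

/-- The mean of `|W (y - m)|²`, for `m` the mean of `ρ`. -/
theorem integral_dotProduct_mulVec_sub_mean [IsFiniteMeasure ρ]
    (hρ : ∀ i, MemLp (fun y : ι → ℝ => y i) 2 ρ) (W : Matrix ι ι ℝ) :
    Integrable (fun y => W.mulVec (y - fun i => ∫ z, z i ∂ρ) ⬝ᵥ
        W.mulVec (y - fun i => ∫ z, z i ∂ρ)) ρ ∧
      ∫ y, W.mulVec (y - fun i => ∫ z, z i ∂ρ) ⬝ᵥ W.mulVec (y - fun i => ∫ z, z i ∂ρ) ∂ρ =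
        (W.transpose * W * coordCov ρ).trace := by
  set m : ι → ℝ := fun i => ∫ z, z i ∂ρ with hm
  have hint : ∀ i j, Integrable (fun y : ι → ℝ => (y i - m i) * (y j - m j)) ρ := fun i j =>
    ((hρ i).sub (memLp_const _)).integrable_mul ((hρ j).sub (memLp_const _))
  have h : (fun y : ι → ℝ => W.mulVec (y - m) ⬝ᵥ W.mulVec (y - m)) =
      fun y => ∑ i, ∑ j, (W.transpose * W) i j * ((y i - m i) * (y j - m j)) := by
    ext y
    rw [Matrix.dotProduct_mulVec, ← Matrix.mulVec_transpose, Matrix.mulVec_mulVec]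
    simp only [Matrix.mulVec, dotProduct, Finset.sum_mul, Pi.sub_apply]
    rw [Finset.sum_comm]
    refine Finset.sum_congr rfl fun i _ => Finset.sum_congr rfl fun j _ => ?_
    -- Exchanging the sums swapped the indices; `Wᵀ * W` is symmetric.
    rw [← Matrix.transpose_apply (W.transpose * W), Matrix.transpose_mul, Matrix.transpose_transpose]
    ring
  rw [h]
  refine ⟨integrable_finsetSum _ fun i _ => integrable_finsetSum _ fun j _ =>
    (hint i j).const_mul _, ?_⟩
  refine (integral_finsetSum _ fun i _ => integrable_finsetSum _ fun j _ =>
    (hint i j).const_mul _).trans ?_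
  simp only [Matrix.trace, Matrix.diag_apply, Matrix.mul_apply (M := W.transpose * W)]
  refine Finset.sum_congr rfl fun i _ => ?_
  refine (integral_finsetSum _ fun j _ => (hint i j).const_mul _).trans ?_
  refine Finset.sum_congr rfl fun j _ => ?_
  rw [integral_const_mul]
  congr 1
  rw [← coordCov_isHermitian.apply]
  rfl

end CovarianceMatrix

/-! ### Maximum entropy of the Gaussian -/

namespace RegionMI

variable {d : ℕ}

theorem gaussianEntropy_eq {S : Matrix (Fin d) (Fin d) ℝ} (hS : 0 < S.det) :
    gaussianEntropy S =
      d / 2 * Real.log (2 * Real.pi * Real.exp 1) + 1 / 2 * Real.log S.det := by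
  have h : (0 : ℝ) < 2 * Real.pi * Real.exp 1 := by positivity
  rw [gaussianEntropy, Real.log_mul (pow_pos h d).ne' hS.ne', Real.log_pow]
  ring

/-- Among the probability densities with a given nondegenerate covariance matrix, the Gaussian one
has the largest differential entropy. -/
theorem neg_integral_log_le_gaussianEntropy {q : (Fin d → ℝ) → ENNReal} (hq : Measurable q)
    {ρ : Measure (Fin d → ℝ)} [IsProbabilityMeasure ρ] (hρq : ρ = volume.withDensity q)
    (hρ : ∀ i, MemLp (fun y : Fin d → ℝ => y i) 2 ρ)
    (hlog : Integrable (fun y => Real.log (q y).toReal) ρ) :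
    -∫ y, Real.log (q y).toReal ∂ρ ≤ gaussianEntropy (coordCov ρ) := by
  have hS : (coordCov ρ).PosDef :=
    posDef_coordCov (hρq ▸ withDensity_absolutelyContinuous _ _) hρ
  obtain ⟨W, hW, hSW⟩ := hS.inv.exists_transpose_mul_self
  obtain ⟨hQi, hQ⟩ := integral_dotProduct_mulVec_sub_mean hρ W
  obtain ⟨hGi, hG⟩ := integrable_exp_neg_half_dotProduct_mulVec hW (fun i => ∫ z, z i ∂ρ)
  set Q : (Fin d → ℝ) → ℝ := fun y =>
    W.mulVec (y - fun i => ∫ z, z i ∂ρ) ⬝ᵥ W.mulVec (y - fun i => ∫ z, z i ∂ρ) with hQdef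
  have htr : ∫ y, Q y ∂ρ = d := by
    rw [hQ, ← hSW, Matrix.nonsing_inv_mul _ hS.det_pos.ne'.isUnit, Matrix.trace_one,
      Fintype.card_fin]
  -- The normalising constant: `exp (-Q / 2) / Z` is the Gaussian density with the mean and
  -- covariance of `ρ`.
  set Z : ℝ := |W.det|⁻¹ * √(2 * Real.pi) ^ Fintype.card (Fin d) with hZ
  have hZpos : 0 < Z := by positivity
  have hlogZ : Real.log Z = 1 / 2 * Real.log (coordCov ρ).det + d / 2 * Real.log (2 * Real.pi) := by
    have hdet : (coordCov ρ).det⁻¹ = W.det * W.det := by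
      rw [← Ring.inverse_eq_inv', ← Matrix.det_nonsing_inv, hSW, Matrix.det_mul,
        Matrix.det_transpose]
    have hl := congrArg Real.log hdet
    rw [Real.log_inv, Real.log_mul hW hW] at hl
    rw [hZ, Real.log_mul (by positivity) (by positivity), Real.log_inv, Real.log_abs, Real.log_pow,
      Real.log_sqrt (by positivity), Fintype.card_fin]
    linarith
  have hqfin : ∀ᵐ y, q y < ⊤ := by
    refine ae_lt_top hq ?_
    rw [← setLIntegral_univ, ← withDensity_apply _ MeasurableSet.univ, ← hρq]
    exact measure_ne_top _ _
  have hEi : Integrable (fun y => Real.exp (-Q y / 2)) := hGi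
  have hE : ∫ y, Real.exp (-Q y / 2) = Z := hG
  -- Gibbs' inequality before integration: `log t ≤ t - 1` at `t` the Gaussian density over `q`,
  -- multiplied by `q`. Where `(q y).toReal = 0` the left side vanishes. The right side integrates
  -- to `1 - 1 = 0`.
  have key : ∀ y, (q y).toReal * (-Q y / 2 - Real.log Z - Real.log (q y).toReal) ≤
      Real.exp (-Q y / 2) * Z⁻¹ - (q y).toReal := by
    intro y
    rcases (ENNReal.toReal_nonneg (a := q y)).eq_or_lt with h | h
    · rw [← h]
      simp only [zero_mul, sub_zero]
      positivity
    · have h1 := Real.log_le_sub_one_of_pos (x := Real.exp (-Q y / 2) * Z⁻¹ / (q y).toReal)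
        (by positivity)
      rw [Real.log_div (by positivity) h.ne', Real.log_mul (by positivity) (by positivity),
        Real.log_exp, Real.log_inv] at h1
      have h2 := mul_le_mul_of_nonneg_left h1 h.le
      rw [mul_sub _ (_ / _) 1, mul_div_cancel₀ _ h.ne', mul_one] at h2
      linarith
  have hconv : ∀ f : (Fin d → ℝ) → ℝ, Integrable f ρ →
      Integrable (fun y => (q y).toReal * f y) ∧ ∫ y, (q y).toReal * f y = ∫ y, f y ∂ρ := by
    intro f hf
    rw [hρq] at hf
    refine ⟨(integrable_withDensity_iff_integrable_smul' hq hqfin).1 hf, ?_⟩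
    rw [hρq, integral_withDensity_eq_integral_toReal_smul hq hqfin]
    rfl
  have hQ2 : Integrable (fun y => -Q y / 2) ρ := hQi.neg.div_const 2
  have hQZ : Integrable (fun y => -Q y / 2 - Real.log Z) ρ := hQ2.sub (integrable_const _)
  obtain ⟨hL, hLe⟩ := hconv _ (hQZ.sub hlog)
  obtain ⟨h1, h1e⟩ := hconv _ (integrable_const 1)
  simp only [mul_one, integral_const, probReal_univ, smul_eq_mul] at h1 h1e
  have hle : ∫ y, (q y).toReal * (-Q y / 2 - Real.log Z - Real.log (q y).toReal) ≤
      ∫ y, (Real.exp (-Q y / 2) * Z⁻¹ - (q y).toReal) :=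
    integral_mono hL ((hEi.mul_const Z⁻¹).sub h1) key
  simp only [Pi.sub_apply] at hL hLe
  rw [hLe, integral_sub (hEi.mul_const _) h1, integral_mul_const, hE, h1e,
    mul_inv_cancel₀ hZpos.ne', sub_self, integral_sub hQZ hlog,
    integral_sub hQ2 (integrable_const _), integral_div, integral_neg, htr] at hle
  simp only [integral_const, probReal_univ, smul_eq_mul, one_mul] at hle
  rw [gaussianEntropy_eq hS.det_pos, Real.log_mul (by positivity) (by positivity), Real.log_exp]
  linarith

end RegionMI

/-! ### Densities of conditional distributions -/

section ConditionalDensity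

variable {Ω E F : Type*} [MeasurableSpace Ω] [MeasurableSpace E] [MeasurableSpace F]
  {μ : Measure Ω}

theorem ae_toReal_pdf_pos [IsFiniteMeasure μ] (X : Ω → E) (α : Measure E) [SigmaFinite α]
    [HasPDF X μ α] : ∀ᵐ ω ∂μ, 0 < (pdf X μ α (X ω)).toReal := by
  have hac : μ.map X ≪ α := HasPDF.absolutelyContinuous
  have hlt : ∀ᵐ x ∂α, pdf X μ α x < ⊤ := pdf.ae_lt_top
  have h : ∀ᵐ x ∂μ.map X, 0 < (pdf X μ α x).toReal := by
    filter_upwards [Measure.rnDeriv_pos hac, hac.ae_le hlt]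
      with x hx hx'
    exact ENNReal.toReal_pos hx.ne' hx'.ne
  exact ae_of_ae_map (HasPDF.aemeasurable X μ α) h

variable (α : Measure E) (β : Measure F) [SigmaFinite α] [SigmaFinite β] {Y : Ω → E} {P : Ω → F}

theorem map_eq_withDensity_lintegral_pdf (hpdf : HasPDF (fun ω => (Y ω, P ω)) μ (α.prod β)) :
    μ.map P = β.withDensity fun p => ∫⁻ y, pdf (fun ω => (Y ω, P ω)) μ (α.prod β) (y, p) ∂α := by
  have hYP := hpdf.aemeasurable
  have h : μ.map P = (μ.map fun ω => (Y ω, P ω)).map Prod.snd := by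
    rw [AEMeasurable.map_map_of_aemeasurable measurable_snd.aemeasurable hYP]
    rfl
  ext s hs
  rw [h, Measure.map_apply measurable_snd hs, map_eq_setLIntegral_pdf _ _ (α.prod β)
    (measurable_snd hs), withDensity_apply _ hs, ← Set.univ_prod, setLIntegral_prod_symm _
    (measurable_pdf _ _ _).aemeasurable]
  simp

/-- The conditional distribution has the density `f(y, p) / f(p)`. -/
theorem condDistrib_ae_eq_withDensity_pdf [StandardBorelSpace E] [Nonempty E] [IsFiniteMeasure μ]
    (hpdf : HasPDF (fun ω => (Y ω, P ω)) μ (α.prod β)) (hP : HasPDF P μ β) :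
    ∀ᵐ p ∂μ.map P, condDistrib Y P μ p = α.withDensity fun y =>
      pdf (fun ω => (Y ω, P ω)) μ (α.prod β) (y, p) / pdf P μ β p := by
  have hYP := hpdf.aemeasurable
  have hmapP := map_eq_withDensity_lintegral_pdf α β hpdf
  set f := pdf (fun ω => (Y ω, P ω)) μ (α.prod β) with hf
  have hfm : Measurable f := measurable_pdf _ _ _
  set g : F → ENNReal := fun p => ∫⁻ y, f (y, p) ∂α with hg
  have hgm : Measurable g := hfm.lintegral_prod_left'
  have hgP : pdf P μ β =ᵐ[β] g := pdf.eq_of_map_eq_withDensity' g hgm.aemeasurable |>.1 hmapP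
  have hgtop : ∀ᵐ p ∂β, g p < ⊤ := by
    have hlt : ∀ᵐ p ∂β, pdf P μ β p < ⊤ := pdf.ae_lt_top
    filter_upwards [hgP, hlt] with p h1 h2
    rwa [← h1]
  have hqm : Measurable (Function.uncurry fun p y => f (y, p) / g p) :=
    (hfm.comp measurable_swap).div (hgm.comp measurable_fst)
  let κ : Kernel F E := Kernel.withDensity (Kernel.const F α) fun p y => f (y, p) / g p
  have hκ : ∀ p s, κ p s = (∫⁻ y in s, f (y, p) ∂α) / g p := fun p s => by
    have hfp : Measurable fun y => f (y, p) := hfm.comp measurable_prodMk_right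
    rw [Kernel.withDensity_apply' _ hqm, Kernel.const_apply]
    simp only [ENNReal.div_eq_inv_mul]
    exact lintegral_const_mul _ hfp
  -- No exceptional set of `p` is needed: in `ENNReal`, `g p / g p ≤ 1` even when `g p` is `0` or
  -- `⊤`.
  have hfin : IsFiniteKernel κ := ⟨1, ENNReal.one_lt_top, fun p => by
    rw [hκ, setLIntegral_univ]
    exact ENNReal.div_self_le_one⟩
  have hY : AEMeasurable Y μ := measurable_fst.comp_aemeasurable hYP
  have heq : μ.map (fun ω => (P ω, Y ω)) = μ.map P ⊗ₘ κ := by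
    have hswap : μ.map (fun ω => (P ω, Y ω)) = (μ.map fun ω => (Y ω, P ω)).map Prod.swap := by
      rw [AEMeasurable.map_map_of_aemeasurable measurable_swap.aemeasurable hYP]
      rfl
    ext s hs
    rw [hswap, Measure.map_apply measurable_swap hs, map_eq_setLIntegral_pdf _ _ (α.prod β)
      (measurable_swap hs), ← lintegral_indicator (measurable_swap hs), lintegral_prod_symm _
      (hfm.indicator (measurable_swap hs)).aemeasurable, Measure.compProd_apply hs, hmapP,
      lintegral_withDensity_eq_lintegral_mul _ hgm (Kernel.measurable_kernel_prodMk_left hs)]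
    refine lintegral_congr_ae ?_
    filter_upwards [hgtop] with p hp
    have hps : MeasurableSet (Prod.mk p ⁻¹' s) := measurable_prodMk_left hs
    rw [Pi.mul_apply, hκ, ← lintegral_indicator hps]
    have hle : ∫⁻ y, (Prod.mk p ⁻¹' s).indicator (fun y => f (y, p)) y ∂α ≤ g p :=
      lintegral_mono fun y => Set.indicator_le_self _ _ _
    refine Eq.trans (b := ∫⁻ y, (Prod.mk p ⁻¹' s).indicator (fun y => f (y, p)) y ∂α) rfl ?_
    -- If `g p = 0` the division cannot be cancelled, but the integral over the section is at most
    -- `g p`, so both sides are zero.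
    by_cases h0 : g p = 0
    · rw [h0] at hle ⊢
      rw [zero_mul]
      exact le_antisymm hle zero_le
    · rw [ENNReal.mul_div_cancel h0 hp.ne]
  have hac : μ.map P ≪ β := HasPDF.absolutelyContinuous
  filter_upwards [condDistrib_ae_eq_of_measure_eq_compProd P hY heq, hac.ae_le hgP] with p h1 h2
  rw [h1, h2, Kernel.withDensity_apply _ hqm, Kernel.const_apply]

/-- The tower property: the law of `(P, Y)` disintegrates into the law of `P` and the conditional
distributions, so Fubini applies. -/
theorem integral_integral_condDistrib [StandardBorelSpace E] [Nonempty E] [IsFiniteMeasure μ]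
    (hP : AEMeasurable P μ) (hY : AEMeasurable Y μ) {F : F × E → ℝ}
    (hF : Integrable F (μ.map fun ω => (P ω, Y ω))) :
    ∫ ω, ∫ y, F (P ω, y) ∂condDistrib Y P μ (P ω) ∂μ = ∫ ω, F (P ω, Y ω) ∂μ := by
  have h := integral_map (hP.prodMk hY) hF.1
  rw [← h, ← integral_map (f := fun p => ∫ y, F (p, y) ∂condDistrib Y P μ p) hP
    (hF.1.integral_condDistrib_map hY)]
  rw [← compProd_map_condDistrib hY] at hF ⊢
  exact (Measure.integral_compProd hF).symm

end ConditionalDensity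

namespace RegionMI

variable {Ω : Type*} [MeasurableSpace Ω] {d : ℕ} {μ : Measure Ω} {Y P : Ω → Fin d → ℝ}

theorem posteriorCov_eq_coordCov [IsFiniteMeasure μ] (p : Fin d → ℝ) :
    posteriorCov Y P μ p = coordCov (condDistrib Y P μ p) := rfl

theorem hasPDF_fst_of_hasPDF_prodMk [IsFiniteMeasure μ]
    (hpdf : HasPDF (fun ω => (Y ω, P ω)) μ volume) : HasPDF Y μ volume :=
  pdf.quasiMeasurePreserving_hasPDF' (μ := volume) (fun ω => (Y ω, P ω)) Measure.quasiMeasurePreserving_fst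

theorem hasPDF_snd_of_hasPDF_prodMk [IsFiniteMeasure μ]
    (hpdf : HasPDF (fun ω => (Y ω, P ω)) μ volume) : HasPDF P μ volume :=
  pdf.quasiMeasurePreserving_hasPDF' (μ := volume) (fun ω => (Y ω, P ω)) Measure.quasiMeasurePreserving_snd

/-! ### Entropies as expectations of log densities -/

section Entropy

theorem measurable_density : Measurable (density Y μ) := (measurable_pdf _ _ _).ennreal_toReal

theorem measurable_jointDensity : Measurable (jointDensity Y P μ) :=
  (measurable_pdf _ _ _).ennreal_toReal

theorem measurable_log_condDensity :
    Measurable fun z => Real.log (jointDensity Y P μ z / density P μ z.2) :=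
  (measurable_jointDensity.div (measurable_density.comp measurable_snd)).log

variable [IsProbabilityMeasure μ]

theorem integrable_entropyIntegrand_iff [HasPDF Y μ volume] :
    Integrable (entropyIntegrand Y μ) ↔ Integrable (fun ω => Real.log (density Y μ (Y ω))) μ :=
  pdf.integrable_pdf_smul_iff measurable_density.log.aestronglyMeasurable

theorem entropy_eq [HasPDF Y μ volume] :
    entropy Y μ = -∫ ω, Real.log (density Y μ (Y ω)) ∂μ :=
  congrArg Neg.neg (pdf.integral_pdf_smul measurable_density.log.aestronglyMeasurable)

variable (hpdf : HasPDF (fun ω => (Y ω, P ω)) μ volume)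
include hpdf

theorem integrable_condEntropyIntegrand_iff :
    Integrable (condEntropyIntegrand Y P μ) ↔
      Integrable (fun ω => Real.log (jointDensity Y P μ (Y ω, P ω) / density P μ (P ω))) μ :=
  pdf.integrable_pdf_smul_iff measurable_log_condDensity.aestronglyMeasurable

theorem condEntropy_eq :
    condEntropy Y P μ =
      -∫ ω, Real.log (jointDensity Y P μ (Y ω, P ω) / density P μ (P ω)) ∂μ :=
  congrArg Neg.neg (pdf.integral_pdf_smul measurable_log_condDensity.aestronglyMeasurable)

theorem integrable_mutualInfoIntegrand_and_mutualInfo_eq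
    (hHY : Integrable (entropyIntegrand Y μ)) (hHYP : Integrable (condEntropyIntegrand Y P μ)) :
    Integrable (mutualInfoIntegrand Y P μ) ∧
      mutualInfo Y P μ = entropy Y μ - condEntropy Y P μ := by
  have hY := hasPDF_fst_of_hasPDF_prodMk hpdf
  have hP := hasPDF_snd_of_hasPDF_prodMk hpdf
  have hm : AEStronglyMeasurable (fun z => Real.log (jointDensity Y P μ z /
      (density Y μ z.1 * density P μ z.2))) volume :=
    (measurable_jointDensity.div ((measurable_density.comp measurable_fst).mul
      (measurable_density.comp measurable_snd))).log.aestronglyMeasurable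
  rw [integrable_entropyIntegrand_iff] at hHY
  rw [integrable_condEntropyIntegrand_iff hpdf] at hHYP
  -- All three densities are almost surely positive along the random vectors, so the logarithm of
  -- the quotient splits.
  have hlog : (fun ω => Real.log (jointDensity Y P μ (Y ω, P ω) /
      (density Y μ (Y ω) * density P μ (P ω)))) =ᵐ[μ] fun ω =>
      Real.log (jointDensity Y P μ (Y ω, P ω) / density P μ (P ω)) -
        Real.log (density Y μ (Y ω)) := by
    filter_upwards [ae_toReal_pdf_pos (μ := μ) (fun ω => (Y ω, P ω)) volume,
      ae_toReal_pdf_pos (μ := μ) Y volume, ae_toReal_pdf_pos (μ := μ) P volume] with ω h1 h2 h3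
    have h1' : 0 < jointDensity Y P μ (Y ω, P ω) := h1
    have h2' : 0 < density Y μ (Y ω) := h2
    have h3' : 0 < density P μ (P ω) := h3
    rw [Real.log_div h1'.ne' (mul_pos h2' h3').ne', Real.log_mul h2'.ne' h3'.ne',
      Real.log_div h1'.ne' h3'.ne']
    ring
  constructor
  · exact (pdf.integrable_pdf_smul_iff hm).2 ((hHYP.sub hHY).congr hlog.symm)
  · have h : mutualInfo Y P μ = _ := pdf.integral_pdf_smul hm
    rw [h, integral_congr_ae hlog, integral_sub hHYP hHY, entropy_eq, condEntropy_eq hpdf]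
    ring

end Entropy

/-! ### Moments of the conditional distributions -/

section PosteriorCovariance

variable [IsProbabilityMeasure μ] (hP : AEMeasurable P μ) (hY : AEMeasurable Y μ)
include hP hY

theorem ae_memLp_condDistrib (hY2 : ∀ i, MemLp (fun ω => Y ω i) 2 μ) :
    ∀ᵐ ω ∂μ, ∀ i, MemLp (fun y : Fin d → ℝ => y i) 2 (condDistrib Y P μ (P ω)) := by
  refine ae_all_iff.2 fun i => ?_
  have hi : Integrable (fun z : (Fin d → ℝ) × (Fin d → ℝ) => z.2 i ^ 2)
      (μ.map fun ω => (P ω, Y ω)) :=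
    (integrable_map_measure (Measurable.aestronglyMeasurable (by fun_prop)) (hP.prodMk hY)).2
      (hY2 i).integrable_sq
  filter_upwards [hi.condDistrib_ae hP hY] with ω h
  exact (memLp_two_iff_integrable_sq (Measurable.aestronglyMeasurable (by fun_prop))).2 h

/-- The covariance is a conditional second moment minus a product of conditional means. That product
is dominated by the sum of two conditional second moments, since variances are nonnegative. -/
theorem integrable_posteriorCov (hY2 : ∀ i, MemLp (fun ω => Y ω i) 2 μ) (i j : Fin d) :
    Integrable (fun ω => posteriorCov Y P μ (P ω) i j) μ := by
  have hm := ae_memLp_condDistrib hP hY hY2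
  have h2 : ∀ i j, Integrable (fun ω => ∫ y, y i * y j ∂condDistrib Y P μ (P ω)) μ := fun i j =>
    Integrable.integral_condDistrib (f := fun z : (Fin d → ℝ) × (Fin d → ℝ) => z.2 i * z.2 j) hP hY
      ((integrable_map_measure (Measurable.aestronglyMeasurable (by fun_prop)) (hP.prodMk hY)).2
        ((hY2 i).integrable_mul (hY2 j)))
  have h1 : ∀ i, Integrable (fun ω => ∫ y, y i ∂condDistrib Y P μ (P ω)) μ := fun i =>
    Integrable.integral_condDistrib (f := fun z : (Fin d → ℝ) × (Fin d → ℝ) => z.2 i) hP hY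
      ((integrable_map_measure (Measurable.aestronglyMeasurable (by fun_prop)) (hP.prodMk hY)).2
        ((hY2 i).integrable one_le_two))
  have h11 : Integrable (fun ω => (∫ y, y i ∂condDistrib Y P μ (P ω)) *
      ∫ y, y j ∂condDistrib Y P μ (P ω)) μ := by
    refine Integrable.mono' ((h2 i i).add (h2 j j)) ((h1 i).1.mul (h1 j).1) ?_
    filter_upwards [hm] with ω hω
    have hvar : ∀ k, (∫ y, y k ∂condDistrib Y P μ (P ω)) ^ 2 ≤
        ∫ y, y k * y k ∂condDistrib Y P μ (P ω) := fun k => by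
      have h := covariance_eq_sub (hω k) (hω k)
      rw [covariance_self (hω k).aemeasurable] at h
      have := variance_nonneg (fun y : Fin d → ℝ => y k) (condDistrib Y P μ (P ω))
      simp only [Pi.mul_apply] at h
      nlinarith
    have hi := hvar i
    have hj := hvar j
    rw [Real.norm_eq_abs, abs_le, Pi.add_apply]
    constructor <;> nlinarith [sq_nonneg ((∫ y, y i ∂condDistrib Y P μ (P ω)) +
      ∫ y, y j ∂condDistrib Y P μ (P ω)), sq_nonneg ((∫ y, y i ∂condDistrib Y P μ (P ω)) -
      ∫ y, y j ∂condDistrib Y P μ (P ω))]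
  refine ((h2 i j).sub h11).congr ?_
  filter_upwards [hm] with ω hω
  exact (covariance_eq_sub (hω i) (hω j)).symm

end PosteriorCovariance

/-- The mean of an integrable random positive definite matrix is positive definite. -/
theorem posDef_integral {ι : Type*} [Fintype ι] [IsProbabilityMeasure μ] {S : Ω → Matrix ι ι ℝ}
    (hS : ∀ᵐ ω ∂μ, (S ω).PosDef) (hi : ∀ i j, Integrable (fun ω => S ω i j) μ) :
    (Matrix.of fun i j => ∫ ω, S ω i j ∂μ).PosDef := by
  refine .of_dotProduct_mulVec_pos ?_ fun x hx => ?_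
  · ext i j
    refine integral_congr_ae ?_
    filter_upwards [hS] with ω hω
    exact hω.1.apply i j
  · have hint : ∀ i j, Integrable (fun ω => x i * (S ω i j * x j)) μ := fun i j =>
      ((hi i j).mul_const _).const_mul _
    have hintS : ∀ i, Integrable (fun ω => ∑ j, x i * (S ω i j * x j)) μ := fun i =>
      integrable_finsetSum _ fun j _ => hint i j
    have h : star x ⬝ᵥ (Matrix.of fun i j => ∫ ω, S ω i j ∂μ).mulVec x =
        ∫ ω, ∑ i, ∑ j, x i * (S ω i j * x j) ∂μ := by
      rw [integral_finsetSum _ fun i _ => hintS i]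
      simp only [star_trivial, Matrix.mulVec, dotProduct, Finset.mul_sum, Matrix.of_apply]
      refine Finset.sum_congr rfl fun i _ => ?_
      rw [integral_finsetSum _ fun j _ => hint i j]
      refine Finset.sum_congr rfl fun j _ => ?_
      rw [integral_const_mul, integral_mul_const]
    have hpos : ∀ᵐ ω ∂μ, 0 < ∑ i, ∑ j, x i * (S ω i j * x j) := by
      filter_upwards [hS] with ω hω
      have := hω.dotProduct_mulVec_pos hx
      simpa only [star_trivial, Matrix.mulVec, dotProduct, Finset.mul_sum] using this
    rw [h, integral_pos_iff_support_of_nonneg_ae (hpos.mono fun ω hω => hω.le)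
      (integrable_finsetSum _ fun i _ => hintS i)]
    have hsupp : Function.support (fun ω => ∑ i, ∑ j, x i * (S ω i j * x j)) =ᵐ[μ] Set.univ := by
      filter_upwards [hpos] with ω hω
      exact eq_true hω.ne'
    rw [measure_congr hsupp, measure_univ]
    exact one_pos

/-! ### Integrability and Jensen's inequality for `log det` -/

section LogDet

variable [IsProbabilityMeasure μ] {S : Ω → Matrix (Fin d) (Fin d) ℝ}
  (hS : ∀ᵐ ω ∂μ, (S ω).PosDef) (hi : ∀ i j, Integrable (fun ω => S ω i j) μ)
include hS hi

/-- A lower bound on the Gaussian entropy makes it integrable: concavity of `log det` supplies the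
upper bound. -/
theorem integrable_gaussianEntropy_of_le {h : Ω → ℝ} (hh : Integrable h μ)
    (hle : ∀ᵐ ω ∂μ, h ω ≤ gaussianEntropy (S ω)) :
    Integrable (fun ω => gaussianEntropy (S ω)) μ := by
  have hdet : AEMeasurable (fun ω => (S ω).det) μ := by
    simp only [Matrix.det_apply]
    exact Finset.aemeasurable_fun_sum _ fun σ _ => AEMeasurable.const_smul
      (Finset.aemeasurable_fun_prod _ fun i _ => (hi _ _).aemeasurable) _
  have htr : Integrable (fun ω => (S ω).trace) μ := integrable_finsetSum _ fun i _ => hi i i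
  have hu : Integrable (fun ω => d / 2 * Real.log (2 * Real.pi * Real.exp 1) +
      1 / 2 * ((S ω).trace - d)) μ :=
    (integrable_const _).add ((htr.sub (integrable_const _)).const_mul _)
  have hm : AEStronglyMeasurable (fun ω => gaussianEntropy (S ω)) μ :=
    ((hdet.const_mul _).log.const_mul _).aestronglyMeasurable
  refine integrable_of_le_of_le hm hle ?_ hh hu
  filter_upwards [hS] with ω hω
  have := hω.log_det_le_trace_sub_card
  rw [Fintype.card_fin] at this
  rw [gaussianEntropy_eq hω.det_pos]
  linarith

/-- Jensen's inequality for the concave function `log det`. -/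
theorem integral_gaussianEntropy_le
    (hg : Integrable (fun ω => gaussianEntropy (S ω)) μ) :
    ∫ ω, gaussianEntropy (S ω) ∂μ ≤
      gaussianEntropy (Matrix.of fun i j => ∫ ω, S ω i j ∂μ) := by
  have hM := posDef_integral hS hi
  set M : Matrix (Fin d) (Fin d) ℝ := Matrix.of fun i j => ∫ ω, S ω i j ∂μ with hMdef
  have hmul : ∀ i j, Integrable (fun ω => M⁻¹ i j * S ω j i) μ := fun i j => (hi j i).const_mul _
  have hrow : ∀ i, Integrable (fun ω => ∑ j, M⁻¹ i j * S ω j i) μ := fun i =>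
    integrable_finsetSum _ fun j _ => hmul i j
  have htri : Integrable (fun ω => (M⁻¹ * S ω).trace) μ := by
    simp only [Matrix.trace, Matrix.diag_apply, Matrix.mul_apply]
    exact integrable_finsetSum _ fun i _ => hrow i
  -- The trace is linear and `M` is the mean of `S`, so the linear term of the tangent at `M`
  -- averages to zero.
  have htr : ∫ ω, (M⁻¹ * S ω).trace ∂μ = d := by
    have h1 : ∫ ω, (M⁻¹ * S ω).trace ∂μ = (M⁻¹ * M).trace := by
      simp only [Matrix.trace, Matrix.diag_apply, Matrix.mul_apply]
      rw [integral_finsetSum _ fun i _ => hrow i]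
      refine Finset.sum_congr rfl fun i _ => ?_
      rw [integral_finsetSum _ fun j _ => hmul i j]
      exact Finset.sum_congr rfl fun j _ => integral_const_mul _ _
    rw [h1, Matrix.nonsing_inv_mul _ hM.det_pos.ne'.isUnit, Matrix.trace_one, Fintype.card_fin]
  have htrd : Integrable (fun ω => (M⁻¹ * S ω).trace - d) μ := htri.sub (integrable_const _)
  have hle : ∫ ω, gaussianEntropy (S ω) ∂μ ≤
      ∫ ω, (gaussianEntropy M + 1 / 2 * ((M⁻¹ * S ω).trace - d)) ∂μ := by
    refine integral_mono_ae hg ((integrable_const _).add (htrd.const_mul _)) ?_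
    filter_upwards [hS] with ω hω
    have := hω.log_det_le_log_det_add_trace hM
    rw [Fintype.card_fin] at this
    rw [gaussianEntropy_eq hω.det_pos, gaussianEntropy_eq hM.det_pos]
    linarith
  rwa [integral_add (integrable_const _) (htrd.const_mul _),
    integral_const_mul, integral_sub htri (integrable_const _), htr, integral_const,
    integral_const, probReal_univ, one_smul, one_smul, sub_self, mul_zero, add_zero] at hle

end LogDet

end RegionMI

/-! ### The bound on conditional entropy and the theorem -/

namespace RegionMI

variable {Ω : Type*} [MeasurableSpace Ω] {d : ℕ} {μ : Measure Ω} [IsProbabilityMeasure μ]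
  {Y P : Ω → Fin d → ℝ} (hpdf : HasPDF (fun ω => (Y ω, P ω)) μ volume)
include hpdf

theorem ae_condDistrib_eq_withDensity :
    ∀ᵐ ω ∂μ, condDistrib Y P μ (P ω) = volume.withDensity fun y =>
      pdf (fun ω => (Y ω, P ω)) μ volume (y, P ω) / pdf P μ volume (P ω) :=
  ae_of_ae_map (hasPDF_snd_of_hasPDF_prodMk hpdf).aemeasurable
    (condDistrib_ae_eq_withDensity_pdf volume volume hpdf (hasPDF_snd_of_hasPDF_prodMk hpdf))

theorem ae_posDef_posteriorCov (hY2 : ∀ i, MemLp (fun ω => Y ω i) 2 μ) :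
    ∀ᵐ ω ∂μ, (posteriorCov Y P μ (P ω)).PosDef := by
  have hP := (hasPDF_snd_of_hasPDF_prodMk hpdf).aemeasurable
  have hY := (hasPDF_fst_of_hasPDF_prodMk hpdf).aemeasurable
  filter_upwards [ae_condDistrib_eq_withDensity hpdf, ae_memLp_condDistrib hP hY hY2] with ω h1 h2
  rw [posteriorCov_eq_coordCov]
  exact posDef_coordCov (h1 ▸ withDensity_absolutelyContinuous _ _) h2

/-- The entropy of the conditional distribution of `Y` given the value of `P` is integrable, its
mean is the conditional entropy, and it is at most the entropy of the Gaussian distribution with the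
posterior covariance matrix. -/
theorem exists_condEntropy_le_gaussianEntropy (hY2 : ∀ i, MemLp (fun ω => Y ω i) 2 μ)
    (hHYP : Integrable (condEntropyIntegrand Y P μ)) :
    ∃ h : Ω → ℝ, Integrable h μ ∧ ∫ ω, h ω ∂μ = condEntropy Y P μ ∧
      ∀ᵐ ω ∂μ, h ω ≤ gaussianEntropy (posteriorCov Y P μ (P ω)) := by
  have hP := (hasPDF_snd_of_hasPDF_prodMk hpdf).aemeasurable
  have hY := (hasPDF_fst_of_hasPDF_prodMk hpdf).aemeasurable
  -- The log conditional density, with `p` as first coordinate to match the disintegration of the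
  -- law of `(P, Y)`. The witness below is minus its conditional mean.
  let L : (Fin d → ℝ) × (Fin d → ℝ) → ℝ := fun z =>
    Real.log (jointDensity Y P μ (z.2, z.1) / density P μ z.1)
  have hLm : Measurable L := measurable_log_condDensity.comp measurable_swap
  have hL : Integrable L (μ.map fun ω => (P ω, Y ω)) :=
    (integrable_map_measure hLm.aestronglyMeasurable (hP.prodMk hY)).2
      ((integrable_condEntropyIntegrand_iff hpdf).1 hHYP)
  refine ⟨fun ω => -∫ y, L (P ω, y) ∂condDistrib Y P μ (P ω),
    (hL.integral_condDistrib hP hY).neg, ?_, ?_⟩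
  · rw [integral_neg, integral_integral_condDistrib hP hY hL, condEntropy_eq hpdf]
  · filter_upwards [ae_condDistrib_eq_withDensity hpdf, ae_memLp_condDistrib hP hY hY2,
      hL.condDistrib_ae hP hY] with ω h1 h2 h3
    have hq : Measurable fun y =>
        pdf (fun ω => (Y ω, P ω)) μ volume (y, P ω) / pdf P μ volume (P ω) :=
      ((measurable_pdf _ _ _).comp measurable_prodMk_right).div_const _
    have hlog : ∀ y, L (P ω, y) = Real.log
        (pdf (fun ω => (Y ω, P ω)) μ volume (y, P ω) / pdf P μ volume (P ω)).toReal := fun y => by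
      rw [ENNReal.toReal_div]
      rfl
    simp only [hlog] at h3 ⊢
    exact neg_integral_log_le_gaussianEntropy hq h1 h2 h3

end RegionMI

theorem mainTheorem1 {Ω : Type*} [MeasurableSpace Ω] (μ : Measure Ω) [IsProbabilityMeasure μ]
    (d : ℕ) (Y P : Ω → Fin d → ℝ)
    (hpdf : HasPDF (fun ω => (Y ω, P ω)) μ volume)
    (hY2 : ∀ i, MemLp (fun ω => Y ω i) 2 μ)
    (hHY : Integrable (RegionMI.entropyIntegrand Y μ))
    (hHYP : Integrable (RegionMI.condEntropyIntegrand Y P μ)) :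
    -- `I(Y; P)` is finite and equals `H(Y) - H(Y | P)`
    (Integrable (RegionMI.mutualInfoIntegrand Y P μ) ∧
      RegionMI.mutualInfo Y P μ = RegionMI.entropy Y μ - RegionMI.condEntropy Y P μ) ∧
    -- the posterior covariance matrix and its mean are well defined and positive definite
    (∀ᵐ ω ∂μ, (∀ i, MemLp (fun y : Fin d → ℝ => y i) 2 (condDistrib Y P μ (P ω))) ∧
      (RegionMI.posteriorCov Y P μ (P ω)).PosDef) ∧
    (∀ i j, Integrable (fun ω => RegionMI.posteriorCov Y P μ (P ω) i j) μ) ∧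
    (RegionMI.meanPosteriorCov Y P μ).PosDef ∧
    -- the lower bound with the posterior covariance matrix as a function of `P`
    Integrable (fun ω => RegionMI.gaussianEntropy (RegionMI.posteriorCov Y P μ (P ω))) μ ∧
    RegionMI.mutualInfo Y P μ ≥ RegionMI.entropy Y μ -
      ∫ ω, RegionMI.gaussianEntropy (RegionMI.posteriorCov Y P μ (P ω)) ∂μ ∧
    RegionMI.entropy Y μ - ∫ ω, RegionMI.gaussianEntropy (RegionMI.posteriorCov Y P μ (P ω)) ∂μ ≥
      RegionMI.entropy Y μ - RegionMI.gaussianEntropy (RegionMI.meanPosteriorCov Y P μ) ∧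
    -- the lower bound with a single posterior covariance matrix
    RegionMI.mutualInfo Y P μ ≥
      RegionMI.entropy Y μ - RegionMI.gaussianEntropy (RegionMI.meanPosteriorCov Y P μ) ∧
    (∀ S : Matrix (Fin d) (Fin d) ℝ, (∀ᵐ ω ∂μ, RegionMI.posteriorCov Y P μ (P ω) = S) →
      RegionMI.meanPosteriorCov Y P μ = S) ∧
    -- the surrogate is the bound up to terms that do not involve `P`
    RegionMI.entropy Y μ - RegionMI.gaussianEntropy (RegionMI.meanPosteriorCov Y P μ) =
      RegionMI.surrogate (RegionMI.meanPosteriorCov Y P μ) +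
        (RegionMI.entropy Y μ - d / 2 * Real.log (2 * Real.pi * Real.exp 1)) := by
  have hP := (RegionMI.hasPDF_snd_of_hasPDF_prodMk hpdf).aemeasurable
  have hY := (RegionMI.hasPDF_fst_of_hasPDF_prodMk hpdf).aemeasurable
  have hMI := RegionMI.integrable_mutualInfoIntegrand_and_mutualInfo_eq hpdf hHY hHYP
  have hS := RegionMI.ae_posDef_posteriorCov hpdf hY2
  have hi := RegionMI.integrable_posteriorCov hP hY hY2
  obtain ⟨h, hh, hhe, hle⟩ := RegionMI.exists_condEntropy_le_gaussianEntropy hpdf hY2 hHYP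
  have hg := RegionMI.integrable_gaussianEntropy_of_le hS hi hh hle
  have hM : (RegionMI.meanPosteriorCov Y P μ).PosDef := RegionMI.posDef_integral hS hi
  have hI : RegionMI.mutualInfo Y P μ ≥ RegionMI.entropy Y μ -
      ∫ ω, RegionMI.gaussianEntropy (RegionMI.posteriorCov Y P μ (P ω)) ∂μ := by
    rw [hMI.2, ← hhe]
    exact sub_le_sub_left (integral_mono_ae hh hg hle) _
  have hJ : RegionMI.entropy Y μ -
      ∫ ω, RegionMI.gaussianEntropy (RegionMI.posteriorCov Y P μ (P ω)) ∂μ ≥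
      RegionMI.entropy Y μ - RegionMI.gaussianEntropy (RegionMI.meanPosteriorCov Y P μ) :=
    sub_le_sub_left (RegionMI.integral_gaussianEntropy_le hS hi hg) _
  refine ⟨hMI, (RegionMI.ae_memLp_condDistrib hP hY hY2).and hS, hi, hM, hg, hI, hJ, hJ.trans hI,
    fun S hSc => ?_, ?_⟩
  · ext i j
    have hij : (fun ω => RegionMI.posteriorCov Y P μ (P ω) i j) =ᵐ[μ] fun _ => S i j := by
      filter_upwards [hSc] with ω hω
      rw [hω]
    rw [RegionMI.meanPosteriorCov, Matrix.of_apply, integral_congr_ae hij]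
    simp
  · rw [RegionMI.gaussianEntropy_eq hM.det_pos, RegionMI.surrogate]
    ring
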